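/- **Setting.** In the Factoring game, Alice plays an integer $n\ge 2$ and Bob, who sees $n$, answers with a bit string; the winner gets payoff $2$ and the loser payoff $1$, and Bob wins exactly if his answer encodes the prime factorization of $n$. In the $(\epsilon,\delta)$-discounted game ($0<\epsilon,\delta<1$) each player plays a probabilistic multitape Turing machine. Both machines get $\lceil 1/\epsilon\rceil$ and $\lceil 1/\delta\rceil$ in binary as input, and Bob's machine also gets the output of Alice's machine (the empty string if that does not halt). If the machines halt after $t_1$ and $t_2$ steps, Alice's payoff is multiplied by $(1-\epsilon)^{t_1}$ and Bob's by $(1-\delta)^{t_2}$. A player whose machine does not halt gets $0$, and if then the other player's machine halts, that player gets the maximum payoff that its action can have over all actions of the opponent, discounted by its own time. If Alice's machine halts but does not output an integer $\ge 2$, she gets $0$ and Bob is paid as if she had not halted. Let $u_1^{\epsilon,\delta}(S,T)$ and $u_2^{\epsilon,\delta}(S,T)$ be the expected payoffs of Alice and Bob under mixed strategies $S,T$, that is, independent probability distributions over machines, the expectation being over these and over the coin tosses of the machines. The pair $(S,T)$ is an $\eta$-NE of the $(\epsilon,\delta)$-discounted game if no player can gain more than $\eta$ by changing to another mixed strategy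 while the other player keeps his. Let $\delta=\delta(\epsilon)>0$ be a function of $\epsilon$. A pair $(S,T)$ of mixed strategies that do not depend on $\epsilon$ is a *strong uniform NE* if there is a function $f$ with $f(\epsilon)\to 0$ as $\epsilon\to 0^+$ such that, for every $\epsilon\in(0,1)$ with $\delta(\epsilon)\in(0,1)$, $(S,T)$ is an $f(\epsilon)$-NE of the $(\epsilon,\delta(\epsilon))$-discounted game. **Theorem.** Let $\delta=\delta(\epsilon)>0$ with $\delta(\epsilon)=o(\epsilon)$ as $\epsilon\to0^+$, and let $(S,T)$ be any strong uniform NE of the $(\epsilon,\delta(\epsilon))$-discounted Factoring game. Then the payoff pair corresponding to $(S,T)$ is $(1,2)$, that is, $u_1^{\epsilon,\delta(\epsilon)}(S,T)\to 1$ and $u_2^{\epsilon,\delta(\epsilon)}(S,T)\to 2$ as $\epsilon\to 0^+$. -/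

import Mathlib

open Filter Topology MeasureTheory
open scoped ENNReal NNReal

namespace FactoringGame

/-- Tape symbols: the blank, the two bits, and the further symbols `E` of a machine. -/
inductive Sym (E : Type) : Type where
  | blank : Sym E
  | bit (b : Bool) : Sym E
  | extra (e : E) : Sym E

instance (E : Type) : Inhabited (Sym E) := ⟨Sym.blank⟩

/-- What a machine does in one step: the next state, for each tape the symbol written under the
head and the move of that head (`none`: the head stays), and possibly one more output bit. -/
structure Action (Q E I : Type) : Type where
  next : Q
  write : I → Sym E
  move : I → Option Turing.Dir
  emit : Option Bool

/-- A probabilistic multitape Turing machine. It has three tapes that hold the inputs at the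
start, `workTapes` work tapes, and a one-way write-only output tape. In each step it tosses one
fair coin, on which its action may depend. -/
structure PTM : Type 1 where
  State : Type
  finiteState : Finite State
  Extra : Type
  finiteExtra : Finite Extra
  workTapes : ℕ
  start : State
  halting : Set State
  action : State → (Fin 3 ⊕ Fin workTapes → Sym Extra) → Bool →
    Action State Extra (Fin 3 ⊕ Fin workTapes)

namespace PTM

/-- A configuration; `out` is the content of the output tape. -/
structure Config (M : PTM) : Type where
  state : M.State
  tape : Fin 3 ⊕ Fin M.workTapes → Turing.Tape (Sym M.Extra)
  out : List Bool

/-- The initial configuration: each head is on the first symbol of its tape. -/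
def init (M : PTM) (inp : Fin 3 → List Bool) : M.Config where
  state := M.start
  tape := Sum.elim (fun i => Turing.Tape.mk₁ ((inp i).map Sym.bit))
    (fun _ => Turing.Tape.mk₁ [])
  out := []

/-- One step, with the result `b` of the coin toss. -/
def step (M : PTM) (c : M.Config) (b : Bool) : M.Config :=
  let act := M.action c.state (fun i => (c.tape i).head) b
  { state := act.next
    tape := fun i =>
      let T := (c.tape i).write (act.write i)
      match act.move i with
      | none => T
      | some d => T.move d
    out := c.out ++ act.emit.toList }

/-- The configuration after `t` steps, when the coin tosses are `ω 0, ω 1, …`. -/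
def run (M : PTM) (inp : Fin 3 → List Bool) (ω : ℕ → Bool) : ℕ → M.Config
  | 0 => M.init inp
  | t + 1 => M.step (run M inp ω t) (ω t)

open Classical in
/-- The running time (the number of steps until a halting state is first reached) and the output
on the computation path given by the coin tosses `ω`; `none` if this path does not halt. -/
noncomputable def outcome (M : PTM) (inp : Fin 3 → List Bool) (ω : ℕ → Bool) :
    Option (ℕ × List Bool) :=
  if h : ∃ t, (M.run inp ω t).state ∈ M.halting then
    some (Nat.find h, (M.run inp ω (Nat.find h)).out)
  else none

end PTM

/-- The law of an infinite sequence of independent fair coin tosses. -/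
noncomputable def coins : Measure (ℕ → Bool) :=
  Measure.infinitePi fun _ => (PMF.uniformOfFintype Bool).toMeasure

/-- Binary representation, most significant bit first. -/
def binary (n : ℕ) : List Bool := n.bits.reverse

/-- The number that a bit string denotes, most significant bit first. -/
def numVal (x : List Bool) : ℕ := x.foldl (fun v b => 2 * v + b.toNat) 0

/-- A list of numbers as a bit string: each bit `b` of a number is written `1b`, and each number
is terminated by `0`. -/
def encodeList (l : List ℕ) : List Bool :=
  l.flatMap fun p => ((binary p).flatMap fun b => [true, b]) ++ [false]

/-- The string `y` represents the prime factorization of `n` (the primes in any order). -/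
def IsFactorization (n : ℕ) (y : List Bool) : Prop :=
  ∃ l : List ℕ, (∀ p ∈ l, p.Prime) ∧ l.prod = n ∧ y = encodeList l

open Classical in
/-- Undiscounted payoff of Alice, who plays `n`, when Bob answers `y`. -/
noncomputable def u₁ (n : ℕ) (y : List Bool) : ℝ≥0∞ := if IsFactorization n y then 1 else 2

open Classical in
/-- Undiscounted payoff of Bob, who answers `y`, when Alice plays `n`. -/
noncomputable def u₂ (n : ℕ) (y : List Bool) : ℝ≥0∞ := if IsFactorization n y then 2 else 1

/-- The factor `(1 - r) ^ t` by which a payoff is discounted after `t` steps at rate `r`. -/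
noncomputable def discount (r : ℝ) (t : ℕ) : ℝ≥0∞ := ENNReal.ofReal (1 - r) ^ t

/-- Discounted payoff of Alice, given the outcomes `a` and `b` of the computations of Alice and
Bob. It is `0` if she does not halt or does not output a number that is at least `2`; if Bob
does not halt, she gets the maximum over all his answers, discounted by her own time. -/
noncomputable def value₁ (ε : ℝ) : Option (ℕ × List Bool) → Option (ℕ × List Bool) → ℝ≥0∞
  | none, _ => 0
  | some (t, x), none => if 2 ≤ numVal x then discount ε t * ⨆ y, u₁ (numVal x) y else 0
  | some (t, x), some (_, y) => if 2 ≤ numVal x then discount ε t * u₁ (numVal x) y else 0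

/-- Discounted payoff of Bob, given the outcomes `a` and `b` of the computations of Alice and
Bob. It is `0` if he does not halt; if Alice plays no number that is at least `2`, he gets the
maximum over all her moves, discounted by his own time. -/
noncomputable def value₂ (δ : ℝ) : Option (ℕ × List Bool) → Option (ℕ × List Bool) → ℝ≥0∞
  | _, none => 0
  | none, some (t, y) => discount δ t * ⨆ n, ⨆ _ : 2 ≤ n, u₂ n y
  | some (_, x), some (t, y) =>
      discount δ t * if 2 ≤ numVal x then u₂ (numVal x) y else ⨆ n, ⨆ _ : 2 ≤ n, u₂ n y

/-- The inputs of both players: `⌈1/ε⌉` and `⌈1/δ⌉` in binary, and a message (which is empty for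
Alice). -/
noncomputable def inputs (ε δ : ℝ) (msg : List Bool) : Fin 3 → List Bool :=
  ![binary ⌈1 / ε⌉₊, binary ⌈1 / δ⌉₊, msg]

/-- The computation of Alice's machine. -/
noncomputable def outcome₁ (ε δ : ℝ) (M : PTM) (ω : ℕ → Bool) : Option (ℕ × List Bool) :=
  M.outcome (inputs ε δ []) ω

/-- The computation of Bob's machine when the outcome of Alice's machine is `a`: its message is
Alice's output (nothing, if she does not halt). -/
noncomputable def outcome₂ (ε δ : ℝ) (a : Option (ℕ × List Bool)) (N : PTM) (ω : ℕ → Bool) :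
    Option (ℕ × List Bool) :=
  N.outcome (inputs ε δ (a.elim [] Prod.snd)) ω

/-- Expected payoff of Alice when she plays the machine `M` and Bob plays the machine `N`. -/
noncomputable def purePayoff₁ (ε δ : ℝ) (M N : PTM) : ℝ≥0∞ :=
  ∫⁻ ω, ∫⁻ ω', value₁ ε (outcome₁ ε δ M ω) (outcome₂ ε δ (outcome₁ ε δ M ω) N ω') ∂coins ∂coins

/-- Expected payoff of Bob when Alice plays the machine `M` and he plays the machine `N`. -/
noncomputable def purePayoff₂ (ε δ : ℝ) (M N : PTM) : ℝ≥0∞ :=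
  ∫⁻ ω, ∫⁻ ω', value₂ δ (outcome₁ ε δ M ω) (outcome₂ ε δ (outcome₁ ε δ M ω) N ω') ∂coins ∂coins

/-- A mixed strategy: a probability distribution over machines. -/
abbrev Strategy : Type 1 := PMF PTM

/-- Alice's payoff in the `(ε, δ)`-discounted game under independent mixed strategies. -/
noncomputable def payoff₁ (ε δ : ℝ) (S T : Strategy) : ℝ≥0∞ :=
  ∑' M, ∑' N, S M * T N * purePayoff₁ ε δ M N

/-- Bob's payoff in the `(ε, δ)`-discounted game under independent mixed strategies. -/
noncomputable def payoff₂ (ε δ : ℝ) (S T : Strategy) : ℝ≥0∞ :=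
  ∑' M, ∑' N, S M * T N * purePayoff₂ ε δ M N

/-- `(S, T)` is an `η`-Nash equilibrium of the `(ε, δ)`-discounted game. -/
def IsApproxNE (ε δ : ℝ) (η : ℝ≥0) (S T : Strategy) : Prop :=
  (∀ S' : Strategy, payoff₁ ε δ S' T ≤ payoff₁ ε δ S T + η) ∧
    ∀ T' : Strategy, payoff₂ ε δ S T' ≤ payoff₂ ε δ S T + η

/-- `(S, T)` is a strong uniform Nash equilibrium of the `(ε, δ)`-discounted games, where `δ` is a
function of `ε`. The strategies `S` and `T` do not depend on `ε`; the deviations from them may. -/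
def IsStrongUniformNE (δ : ℝ → ℝ) (S T : Strategy) : Prop :=
  ∃ f : ℝ → ℝ≥0, Tendsto f (𝓝[>] 0) (𝓝 0) ∧
    ∀ ε : ℝ, 0 < ε → ε < 1 → 0 < δ ε → δ ε < 1 → IsApproxNE ε (δ ε) (f ε) S T

end FactoringGame

/-! No hardness of factoring enters: the equilibrium conditions force Alice to stop within `O(1/ε)`
steps, and on that scale Bob is practically undiscounted, because `δ = o(ε)`.

Alice can cut her computation off at any time `τ` and name a number at once, which secures her about
`(1 - ε) ^ τ`. Computations running on for another `⌈3 / ε⌉` steps pay at most `2 / 8` of that,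
those ending in between at most twice that. If too many of the computations that survive `τ` also
survived this window, the cut would be profitable; so, up to an equilibrium error, at most a
fraction `5 / 7` of them does (`slow_add_ceil_le`). After `k` windows the surviving probability is
at most `(5 / 7) ^ k + o(1)` for fixed `k` (`eventually_slow_le`).

A message written within `τ` steps has at most `τ` bits. Deviations may depend on `ε`, and the size
of a machine costs nothing, so Bob may store the factorizations of all such messages in a table and
answer in linear time (`le_payoff₂_lookup`). With `τ = O(k / ε)` the discount he suffers is
negligible, hence his equilibrium payoff tends to `2`. The payoffs sum to at most `3`, so Alice is
left with at most `1 + o(1)`; naming `3` immediately secures her `1 - o(1)`. -/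

namespace FactoringGame

/-! ### Runs, output length and measurability -/

namespace PTM

theorem step_eq (M : PTM) (c : M.Config) (b : Bool)
    {act : Action M.State M.Extra (Fin 3 ⊕ Fin M.workTapes)}
    (h : M.action c.state (fun i => (c.tape i).head) b = act) :
    M.step c b =
      { state := act.next
        tape := fun i =>
          let T := (c.tape i).write (act.write i)
          match act.move i with
          | none => T
          | some d => T.move d
        out := c.out ++ act.emit.toList } := by
  subst h
  rfl

theorem outcome_eq_some_iff (M : PTM) (inp : Fin 3 → List Bool) (ω : ℕ → Bool) (t : ℕ)
    (x : List Bool) :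
    M.outcome inp ω = some (t, x) ↔
      (M.run inp ω t).state ∈ M.halting ∧ (∀ s < t, (M.run inp ω s).state ∉ M.halting) ∧
        (M.run inp ω t).out = x := by
  classical
  unfold outcome
  split_ifs with h
  · rw [Option.some_inj, Prod.mk.injEq, ← and_assoc, ← Nat.find_eq_iff h]
    constructor
    · rintro ⟨rfl, rfl⟩
      exact ⟨rfl, rfl⟩
    · rintro ⟨rfl, rfl⟩
      exact ⟨rfl, rfl⟩
  · simp only [false_iff]
    exact fun h' => h ⟨t, h'.1⟩

/-- Each step emits at most one bit. This is what bounds the table that Bob needs against a fast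
Alice. -/
theorem length_run_out_le (M : PTM) (inp : Fin 3 → List Bool) (ω : ℕ → Bool) (t : ℕ) :
    (M.run inp ω t).out.length ≤ t := by
  induction t with
  | zero => simp [run, init]
  | succ t ih =>
    simp only [run, step, List.length_append]
    gcongr
    cases (M.action _ _ _).emit <;> simp

theorem length_le_of_outcome_eq_some {M : PTM} {inp : Fin 3 → List Bool} {ω : ℕ → Bool} {t : ℕ}
    {x : List Bool} (h : M.outcome inp ω = some (t, x)) : x.length ≤ t := by
  rw [outcome_eq_some_iff] at h
  rw [← h.2.2]
  exact M.length_run_out_le inp ω t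

/-- A run of length `t` depends on finitely many coins. In the induction `C` must vary: it is
replaced by its preimage under a step with a fixed coin. -/
theorem measurableSet_run_mem (M : PTM) (inp : Fin 3 → List Bool) (t : ℕ) (C : Set M.Config) :
    MeasurableSet {ω : ℕ → Bool | M.run inp ω t ∈ C} := by
  induction t generalizing C with
  | zero => simp [run]
  | succ t ih =>
    have h : {ω : ℕ → Bool | M.run inp ω (t + 1) ∈ C} =
        ⋃ b : Bool, {ω | ω t = b} ∩ {ω | M.run inp ω t ∈ {c | M.step c b ∈ C}} := by
      ext ω
      simp [run]
    rw [h]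
    refine MeasurableSet.iUnion fun b => MeasurableSet.inter ?_ (ih _)
    exact (measurable_pi_apply (X := fun _ : ℕ => Bool) t) (measurableSet_singleton b)

theorem measurableSet_outcome_eq (M : PTM) (inp : Fin 3 → List Bool) (t : ℕ) (x : List Bool) :
    MeasurableSet {ω | M.outcome inp ω = some (t, x)} := by
  simp only [outcome_eq_some_iff]
  refine (M.measurableSet_run_mem inp t {c | c.state ∈ M.halting}).inter (.inter ?_
    (M.measurableSet_run_mem inp t {c | c.out = x}))
  have h : {ω | ∀ s < t, (M.run inp ω s).state ∉ M.halting} =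
      ⋂ s, ⋂ (_ : s < t), {ω | M.run inp ω s ∈ {c | c.state ∉ M.halting}} := by
    ext ω
    simp
  change MeasurableSet {ω | ∀ s < t, (M.run inp ω s).state ∉ M.halting}
  rw [h]
  exact .iInter fun s => .iInter fun _ => M.measurableSet_run_mem inp s _

/-! ### Truncated machines -/

/-- The machine that runs as `M` for `τ` steps and, if `M` has not halted by then, writes two
more bits `1` and halts. -/
def truncate (τ : ℕ) (M : PTM) : PTM where
  State := M.State × Fin (τ + 3)
  finiteState := have := M.finiteState; inferInstance
  Extra := M.Extra
  finiteExtra := M.finiteExtra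
  workTapes := M.workTapes
  start := (M.start, 0)
  halting := {q | q.1 ∈ M.halting ∨ (q.2 : ℕ) = τ + 2}
  action q h b :=
    if (q.2 : ℕ) < τ then
      let act := M.action q.1 h b
      { next := (act.next, ⟨min (q.2 + 1) (τ + 2), by omega⟩)
        write := act.write
        move := act.move
        emit := act.emit }
    else
      { next := (q.1, ⟨min (q.2 + 1) (τ + 2), by omega⟩)
        write := h
        move := fun _ => none
        emit := some true }

theorem truncate_run (M : PTM) (τ : ℕ) (inp : Fin 3 → List Bool) (ω : ℕ → Bool) (t : ℕ)
    (ht : t ≤ τ) :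
    (M.truncate τ).run inp ω t =
      ⟨((M.run inp ω t).state, ⟨t, by omega⟩), (M.run inp ω t).tape, (M.run inp ω t).out⟩ := by
  induction t with
  | zero => rfl
  | succ t ih =>
    change (M.truncate τ).step _ _ = _
    rw [ih (by omega)]
    have hmin : min (t + 1) (τ + 2) = t + 1 := by omega
    have hact : (M.truncate τ).action ((M.run inp ω t).state, ⟨t, by omega⟩)
        (fun i => ((M.run inp ω t).tape i).head) (ω t) =
        { next := ((M.action (M.run inp ω t).state (fun i => ((M.run inp ω t).tape i).head)
            (ω t)).next, ⟨t + 1, by omega⟩)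
          write := (M.action (M.run inp ω t).state (fun i => ((M.run inp ω t).tape i).head)
            (ω t)).write
          move := (M.action (M.run inp ω t).state (fun i => ((M.run inp ω t).tape i).head)
            (ω t)).move
          emit := (M.action (M.run inp ω t).state (fun i => ((M.run inp ω t).tape i).head)
            (ω t)).emit } := by
      refine (if_pos (show t < τ by omega)).trans ?_
      simp only [hmin]
      rfl
    exact (step_eq (M.truncate τ) _ _ hact).trans rfl

theorem truncate_step (M : PTM) (τ : ℕ) (c : (M.truncate τ).Config) (b : Bool) (t : ℕ)
    (hc : Fin.val c.state.2 = t) (ht : τ ≤ t) :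
    ((M.truncate τ).step c b).state.1 = c.state.1 ∧
      Fin.val ((M.truncate τ).step c b).state.2 = min (t + 1) (τ + 2) ∧
      ((M.truncate τ).step c b).out = c.out ++ [true] := by
  subst hc
  rw [step_eq (M.truncate τ) c b (if_neg (not_lt.2 ht))]
  exact ⟨rfl, rfl, rfl⟩

theorem truncate_outcome_of_le {M : PTM} {τ : ℕ} {inp : Fin 3 → List Bool} {ω : ℕ → Bool}
    {t : ℕ} {x : List Bool} (h : M.outcome inp ω = some (t, x)) (ht : t ≤ τ) :
    (M.truncate τ).outcome inp ω = some (t, x) := by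
  rw [outcome_eq_some_iff] at h ⊢
  obtain ⟨h₁, h₂, h₃⟩ := h
  rw [M.truncate_run τ inp ω t ht]
  refine ⟨Or.inl h₁, fun s hs => ?_, h₃⟩
  rw [M.truncate_run τ inp ω s (by omega)]
  rintro (h | h)
  · exact h₂ s hs h
  · change s = τ + 2 at h
    omega

/-- The state of `M` is frozen, and not halting, during the two extra steps, so only the counter can
stop the machine. The two final bits make the output a legal number whatever `M` has written before.
-/
theorem truncate_outcome_of_forall_notMem {M : PTM} {τ : ℕ} {inp : Fin 3 → List Bool}
    {ω : ℕ → Bool} (h : ∀ s ≤ τ, (M.run inp ω s).state ∉ M.halting) :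
    (M.truncate τ).outcome inp ω = some (τ + 2, (M.run inp ω τ).out ++ [true, true]) := by
  have h₀ := M.truncate_run τ inp ω τ le_rfl
  obtain ⟨a₁, b₁, c₁⟩ := M.truncate_step τ ((M.truncate τ).run inp ω τ) (ω τ) τ (by rw [h₀]) le_rfl
  change ((M.truncate τ).run inp ω (τ + 1)).state.1 = _ at a₁
  change Fin.val ((M.truncate τ).run inp ω (τ + 1)).state.2 = _ at b₁
  change ((M.truncate τ).run inp ω (τ + 1)).out = _ at c₁
  rw [min_eq_left (by omega)] at b₁
  rw [h₀] at a₁ c₁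
  obtain ⟨-, b₂, c₂⟩ := M.truncate_step τ ((M.truncate τ).run inp ω (τ + 1)) (ω (τ + 1)) (τ + 1) b₁
    (by omega)
  rw [outcome_eq_some_iff]
  refine ⟨Or.inr (b₂.trans (by omega)), fun s hs => ?_, c₂.trans (by rw [c₁]; simp)⟩
  rintro (hs' | hs')
  · rcases Nat.lt_or_ge τ s with hlt | hle
    · obtain rfl : s = τ + 1 := by omega
      rw [a₁] at hs'
      exact h τ le_rfl hs'
    · rw [M.truncate_run τ inp ω s hle] at hs'
      exact h s hle hs'
  · rcases Nat.lt_or_ge τ s with hlt | hle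
    · obtain rfl : s = τ + 1 := by omega
      omega
    · rw [M.truncate_run τ inp ω s hle] at hs'
      change s = τ + 2 at hs'
      omega

/-! ### Table machines -/

/-- The transition function of `lookup`. -/
def lookupAction (B : ℕ) (g : List Bool → List Bool) (q : Bool × {l : List Bool // l.length ≤ B})
    (h : Fin 3 ⊕ Fin 0 → Sym Empty) :
    Action (Bool × {l : List Bool // l.length ≤ B}) Empty (Fin 3 ⊕ Fin 0) :=
  if q.1 then
    { next := (true, ⟨q.2.1.tail, by have := q.2.2; simp; omega⟩)
      write := h
      move := fun _ => none
      emit := q.2.1.head? }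
  else
    match h (Sum.inl 2) with
    | .bit b =>
      { next := (false, ⟨(q.2.1 ++ [b]).take B, by simp⟩)
        write := h
        move := fun _ => some Turing.Dir.right
        emit := none }
    | _ =>
      { next := (true, ⟨(g q.2.1).take B, by simp⟩)
        write := h
        move := fun _ => none
        emit := none }

/-- The machine that reads its message `x` and writes `g x`, where `g` is stored as a table for
the `x` with `x` and `g x` of length at most `B`. -/
def lookup (B : ℕ) (g : List Bool → List Bool) : PTM where
  State := Bool × {l : List Bool // l.length ≤ B}
  finiteState := by
    have : Finite {l : List Bool // l.length ≤ B} := List.finite_length_le Bool B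
    infer_instance
  Extra := Empty
  finiteExtra := inferInstance
  workTapes := 0
  start := (false, ⟨[], by simp⟩)
  halting := {q | q.1 = true ∧ q.2.1 = []}
  action q h _ := lookupAction B g q h

theorem lookup_step_bit (B : ℕ) (g : List Bool → List Bool) (c : (lookup B g).Config)
    (r b : Bool) (hq : c.state.1 = false)
    (hb : (c.tape (Sum.inl 2)).head = (Sym.bit b : Sym Empty)) :
    ((lookup B g).step c r).state.1 = false ∧
      ((lookup B g).step c r).state.2.1 = (c.state.2.1 ++ [b]).take B ∧
      ((lookup B g).step c r).tape (Sum.inl 2) = (c.tape (Sum.inl 2)).move Turing.Dir.right ∧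
      ((lookup B g).step c r).out = c.out := by
  have h : ∀ (q : Bool × {l : List Bool // l.length ≤ B}) (h : Fin 3 ⊕ Fin 0 → Sym Empty),
      q.1 = false → h (Sum.inl 2) = Sym.bit b → lookupAction B g q h =
      { next := (false, ⟨(q.2.1 ++ [b]).take B, by simp⟩)
        write := h
        move := fun _ => some Turing.Dir.right
        emit := none } := by
    intro q h hq hb
    simp [lookupAction, hq, hb]
  rw [step_eq (lookup B g) c r (h c.state (fun i => (c.tape i).head) hq hb)]
  refine ⟨rfl, rfl, ?_, List.append_nil _⟩
  exact congrArg (Turing.Tape.move Turing.Dir.right) (Turing.Tape.write_self _)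

theorem lookup_step_blank (B : ℕ) (g : List Bool → List Bool) (c : (lookup B g).Config)
    (r : Bool) (hq : c.state.1 = false)
    (hb : (c.tape (Sum.inl 2)).head = (Sym.blank : Sym Empty)) :
    ((lookup B g).step c r).state.1 = true ∧
      ((lookup B g).step c r).state.2.1 = (g c.state.2.1).take B ∧
      ((lookup B g).step c r).out = c.out := by
  have h : ∀ (q : Bool × {l : List Bool // l.length ≤ B}) (h : Fin 3 ⊕ Fin 0 → Sym Empty),
      q.1 = false → h (Sum.inl 2) = Sym.blank → lookupAction B g q h =
      { next := (true, ⟨(g q.2.1).take B, by simp⟩)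
        write := h
        move := fun _ => none
        emit := none } := by
    intro q h hq hb
    simp [lookupAction, hq, hb]
  rw [step_eq (lookup B g) c r (h c.state (fun i => (c.tape i).head) hq hb)]
  exact ⟨rfl, rfl, List.append_nil _⟩

theorem lookup_step_write (B : ℕ) (g : List Bool → List Bool) (c : (lookup B g).Config)
    (r : Bool) (hq : c.state.1 = true) :
    ((lookup B g).step c r).state.1 = true ∧
      ((lookup B g).step c r).state.2.1 = c.state.2.1.tail ∧
      ((lookup B g).step c r).out = c.out ++ c.state.2.1.head?.toList := by
  rw [step_eq (lookup B g) c r (if_pos hq)]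
  exact ⟨rfl, rfl, rfl⟩

/-- Invariant of the reading phase. The cut to `B` symbols serves only to keep the state space
finite and is never active here. -/
theorem lookup_run_read (B : ℕ) (g : List Bool → List Bool) (inp : Fin 3 → List Bool)
    (ω : ℕ → Bool) (hB : (inp 2).length ≤ B) (k : ℕ) (hk : k ≤ (inp 2).length) :
    ((lookup B g).run inp ω k).state.1 = false ∧
      ((lookup B g).run inp ω k).state.2.1 = (inp 2).take k ∧
      (∃ L, ((lookup B g).run inp ω k).tape (Sum.inl 2) =
        Turing.Tape.mk' L (Turing.ListBlank.mk (((inp 2).drop k).map Sym.bit))) ∧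
      ((lookup B g).run inp ω k).out = [] := by
  induction k with
  | zero => exact ⟨rfl, rfl, ⟨_, rfl⟩, rfl⟩
  | succ k ih =>
    obtain ⟨h₁, h₂, ⟨L, h₃⟩, h₄⟩ := ih (by omega)
    have hd : (inp 2).drop k = (inp 2)[k] :: (inp 2).drop (k + 1) :=
      List.drop_eq_getElem_cons (by omega)
    rw [hd] at h₃
    obtain ⟨s₁, s₂, s₃, s₄⟩ := lookup_step_bit B g ((lookup B g).run inp ω k) (ω k) (inp 2)[k] h₁
      (by rw [h₃]; rfl)
    refine ⟨s₁, s₂.trans ?_, ⟨L.cons (Sym.bit (inp 2)[k] : Sym Empty), s₃.trans ?_⟩, s₄.trans h₄⟩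
    · rw [h₂, List.take_append_getElem, List.take_of_length_le]
      simp
      omega
    · rw [h₃, Turing.Tape.move_right_mk']
      rfl

theorem lookup_run_write (B : ℕ) (g : List Bool → List Bool) (inp : Fin 3 → List Bool)
    (ω : ℕ → Bool) (hB : (inp 2).length ≤ B) (hg : (g (inp 2)).length ≤ B) (k : ℕ) :
    ((lookup B g).run inp ω ((inp 2).length + 1 + k)).state.1 = true ∧
      ((lookup B g).run inp ω ((inp 2).length + 1 + k)).state.2.1 = (g (inp 2)).drop k ∧
      ((lookup B g).run inp ω ((inp 2).length + 1 + k)).out = (g (inp 2)).take k := by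
  induction k with
  | zero =>
    obtain ⟨h₁, h₂, ⟨L, h₃⟩, h₄⟩ := lookup_run_read B g inp ω hB _ le_rfl
    obtain ⟨s₁, s₂, s₃⟩ := lookup_step_blank B g ((lookup B g).run inp ω (inp 2).length)
      (ω (inp 2).length) h₁ (by rw [h₃, List.drop_length]; rfl)
    refine ⟨s₁, s₂.trans ?_, s₃.trans h₄⟩
    rw [h₂, List.take_length, List.take_of_length_le hg, List.drop_zero]
  | succ k ih =>
    obtain ⟨h₁, h₂, h₃⟩ := ih
    obtain ⟨s₁, s₂, s₃⟩ := lookup_step_write B g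
      ((lookup B g).run inp ω ((inp 2).length + 1 + k)) (ω ((inp 2).length + 1 + k)) h₁
    refine ⟨s₁, s₂.trans ?_, s₃.trans ?_⟩
    · rw [h₂, List.tail_drop]
    · rw [h₂, h₃, List.head?_drop, List.take_add_one]

/-- One step per bit read, one on the blank that ends the message, one per bit written; the
complexity of `g` does not matter. -/
theorem lookup_outcome (B : ℕ) (g : List Bool → List Bool) (inp : Fin 3 → List Bool)
    (ω : ℕ → Bool) (hB : (inp 2).length ≤ B) (hg : (g (inp 2)).length ≤ B) :
    (lookup B g).outcome inp ω =
      some ((inp 2).length + 1 + (g (inp 2)).length, g (inp 2)) := by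
  rw [outcome_eq_some_iff]
  have hw := lookup_run_write B g inp ω hB hg
  refine ⟨⟨(hw _).1, by simpa using (hw (g (inp 2)).length).2.1⟩, fun s hs hmem => ?_,
    by simpa using (hw (g (inp 2)).length).2.2⟩
  rcases Nat.lt_or_ge (inp 2).length s with h | h
  · obtain ⟨k, rfl⟩ : ∃ k, s = (inp 2).length + 1 + k := ⟨s - ((inp 2).length + 1), by omega⟩
    have h' := hmem.2
    rw [(hw k).2.1, List.drop_eq_nil_iff] at h'
    omega
  · have h' := hmem.1
    rw [(lookup_run_read B g inp ω hB s h).1] at h'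
    exact Bool.false_ne_true h'

end PTM

/-! ### Length of encoded factorizations -/

theorem two_le_numVal_append (x : List Bool) : 2 ≤ numVal (x ++ [true, true]) := by
  simp [numVal, List.foldl_append]
  omega

theorem numVal_lt_two_pow (x : List Bool) : numVal x < 2 ^ x.length := by
  induction x using List.reverseRecOn with
  | nil => simp [numVal]
  | append_singleton x b ih =>
    have h : numVal (x ++ [b]) = 2 * numVal x + b.toNat := by simp [numVal, List.foldl_append]
    have hb := Bool.toNat_le b
    rw [h, List.length_append, List.length_singleton, pow_succ]
    omega

theorem length_encodeList (l : List ℕ) :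
    (encodeList l).length = (l.map fun p => 2 * p.size + 1).sum := by
  simp [encodeList, List.length_flatMap, binary, Nat.size_eq_bits_len, mul_comm]

/-- A prime `p` costs at most `2 * (log p + 1) + 1` bits, which is at most `5 * log p` since `log p
≥ 1`. -/
theorem length_encodeList_le {l : List ℕ} (hl : ∀ p ∈ l, p.Prime) :
    (encodeList l).length ≤ 5 * Nat.log 2 l.prod := by
  rw [length_encodeList]
  -- `s` is the sum of the rounded-down logarithms of the primes.
  suffices h : ∃ s, (l.map fun p => 2 * p.size + 1).sum ≤ 5 * s ∧ 2 ^ s ≤ l.prod by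
    obtain ⟨s, h₁, h₂⟩ := h
    have := Nat.le_log_of_pow_le one_lt_two h₂
    omega
  induction l with
  | nil => exact ⟨0, by simp⟩
  | cons p l ih =>
    obtain ⟨s, h₁, h₂⟩ := ih fun q hq => hl q (List.mem_cons_of_mem _ hq)
    have hp : p.Prime := hl p List.mem_cons_self
    have hlog : 1 ≤ Nat.log 2 p := Nat.le_log_of_pow_le one_lt_two (by simpa using hp.two_le)
    have hsize : p.size ≤ Nat.log 2 p + 1 := Nat.size_le.2 (Nat.lt_pow_succ_log_self one_lt_two p)
    refine ⟨Nat.log 2 p + s, ?_, ?_⟩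
    · simp only [List.map_cons, List.sum_cons]
      omega
    · rw [pow_add, List.prod_cons]
      exact Nat.mul_le_mul (Nat.pow_log_le_self 2 hp.ne_zero) h₂

/-- A best answer of Bob to the message `x`; where `x` denotes no number that is at least `2`, it
is the factorization of `2`. -/
def factorAnswer (x : List Bool) : List Bool :=
  encodeList (if 2 ≤ numVal x then (numVal x).primeFactorsList else [2])

theorem length_factorAnswer_le (x : List Bool) : (factorAnswer x).length ≤ 5 * x.length + 5 := by
  unfold factorAnswer
  split_ifs with h
  · refine (length_encodeList_le fun p => Nat.prime_of_mem_primeFactorsList).trans ?_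
    rw [Nat.prod_primeFactorsList (by omega)]
    have := Nat.log_lt_of_lt_pow (by omega) (numVal_lt_two_pow x)
    omega
  · exact (length_encodeList_le (by simp [Nat.prime_two])).trans
      (by rw [List.prod_singleton, show Nat.log 2 2 = 1 from Nat.log_pow one_lt_two 1]; omega)

theorem isFactorization_factorAnswer {x : List Bool} (h : 2 ≤ numVal x) :
    IsFactorization (numVal x) (factorAnswer x) :=
  ⟨_, fun _ => Nat.prime_of_mem_primeFactorsList, Nat.prod_primeFactorsList (by omega),
    by rw [factorAnswer, if_pos h]⟩

theorem isFactorization_two_factorAnswer {x : List Bool} (h : ¬ 2 ≤ numVal x) :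
    IsFactorization 2 (factorAnswer x) :=
  ⟨[2], by simp [Nat.prime_two], by simp, by rw [factorAnswer, if_neg h]⟩

/-! ### Payoffs as integrals over the law of Alice's outcome -/

instance : MeasurableSpace (Option (ℕ × List Bool)) := ⊤

instance : DiscreteMeasurableSpace (Option (ℕ × List Bool)) := ⟨fun _ => trivial⟩

instance : IsProbabilityMeasure coins := by
  unfold coins
  infer_instance

theorem PTM.measurable_outcome (M : PTM) (inp : Fin 3 → List Bool) :
    Measurable (M.outcome inp) := by
  refine measurable_to_countable' fun a => ?_
  rcases a with _ | ⟨t, x⟩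
  · have h : M.outcome inp ⁻¹' {none} =
        (⋃ p : ℕ × List Bool, {ω | M.outcome inp ω = some (p.1, p.2)})ᶜ := by
      ext ω
      simp [Option.eq_none_iff_forall_ne_some]
    rw [h]
    exact (MeasurableSet.iUnion fun p : ℕ × List Bool => M.measurableSet_outcome_eq inp p.1 p.2).compl
  · exact M.measurableSet_outcome_eq inp t x

/-- The law of the outcome of Alice's computation. -/
noncomputable def outcomeLaw (ε δ : ℝ) (S : Strategy) : Measure (Option (ℕ × List Bool)) :=
  Measure.sum fun M => S M • coins.map (outcome₁ ε δ M)

theorem lintegral_outcomeLaw (ε δ : ℝ) (S : Strategy) (F : Option (ℕ × List Bool) → ℝ≥0∞) :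
    ∫⁻ a, F a ∂outcomeLaw ε δ S = ∑' M, S M * ∫⁻ ω, F (outcome₁ ε δ M ω) ∂coins := by
  rw [outcomeLaw, lintegral_sum_measure]
  congr 1 with M
  rw [lintegral_smul_measure, smul_eq_mul,
    lintegral_map (g := outcome₁ ε δ M) Measurable.of_discrete (M.measurable_outcome _)]

instance (ε δ : ℝ) (S : Strategy) : IsProbabilityMeasure (outcomeLaw ε δ S) :=
  ⟨by simpa using lintegral_outcomeLaw ε δ S 1⟩

/-- The expected value of a payoff `v` against the strategy `T` of Bob, given the outcome `a` of
Alice's computation. -/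
noncomputable def replyValue (ε δ : ℝ)
    (v : Option (ℕ × List Bool) → Option (ℕ × List Bool) → ℝ≥0∞) (T : Strategy)
    (a : Option (ℕ × List Bool)) : ℝ≥0∞ :=
  ∑' N, T N * ∫⁻ ω, v a (outcome₂ ε δ a N ω) ∂coins

/-- The index `ι` will be the type of machines, for which no countability is assumed. Countability
of `α` turns the integral into a sum, and sums in `ℝ≥0∞` commute. -/
theorem lintegral_tsum_of_countable {α ι : Type*} [Countable α] [MeasurableSpace α]
    [MeasurableSingletonClass α] (μ : Measure α) (F : ι → α → ℝ≥0∞) :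
    ∫⁻ a, ∑' i, F i a ∂μ = ∑' i, ∫⁻ a, F i a ∂μ := by
  simp_rw [lintegral_countable', ← ENNReal.tsum_mul_right]
  exact ENNReal.tsum_comm

/-- Bob's computation depends on Alice's machine and coins only through her outcome. -/
theorem tsum_tsum_eq_lintegral_replyValue (ε δ : ℝ)
    (v : Option (ℕ × List Bool) → Option (ℕ × List Bool) → ℝ≥0∞) (S T : Strategy) :
    ∑' M, ∑' N, S M * T N * ∫⁻ ω, ∫⁻ ω', v (outcome₁ ε δ M ω)
      (outcome₂ ε δ (outcome₁ ε δ M ω) N ω') ∂coins ∂coins =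
    ∫⁻ a, replyValue ε δ v T a ∂outcomeLaw ε δ S := by
  simp_rw [replyValue, lintegral_tsum_of_countable, lintegral_outcomeLaw]
  rw [ENNReal.tsum_comm]
  congr 1 with N
  congr 1 with M
  rw [lintegral_const_mul' _ _ (T.apply_ne_top N), mul_assoc]

theorem payoff₁_eq (ε δ : ℝ) (S T : Strategy) :
    payoff₁ ε δ S T = ∫⁻ a, replyValue ε δ (value₁ ε) T a ∂outcomeLaw ε δ S :=
  tsum_tsum_eq_lintegral_replyValue ε δ (value₁ ε) S T

theorem payoff₂_eq (ε δ : ℝ) (S T : Strategy) :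
    payoff₂ ε δ S T = ∫⁻ a, replyValue ε δ (value₂ δ) T a ∂outcomeLaw ε δ S :=
  tsum_tsum_eq_lintegral_replyValue ε δ (value₂ δ) S T

theorem replyValue_const (ε δ : ℝ) (c : ℝ≥0∞) (T : Strategy) (a : Option (ℕ × List Bool)) :
    replyValue ε δ (fun _ _ => c) T a = c := by
  simp [replyValue, ENNReal.tsum_mul_right]

theorem replyValue_mono (ε δ : ℝ)
    {v w : Option (ℕ × List Bool) → Option (ℕ × List Bool) → ℝ≥0∞} (T : Strategy)
    {a : Option (ℕ × List Bool)} (h : ∀ b, v a b ≤ w a b) :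
    replyValue ε δ v T a ≤ replyValue ε δ w T a :=
  ENNReal.tsum_le_tsum fun _ => by gcongr; exact h _

/-! ### Bounds on payoffs -/

theorem discount_le_one {r : ℝ} (hr : 0 ≤ r) (t : ℕ) : discount r t ≤ 1 :=
  pow_le_one₀ zero_le (ENNReal.ofReal_le_one.2 (by linarith))

theorem discount_anti {r : ℝ} (hr : 0 ≤ r) {s t : ℕ} (h : s ≤ t) :
    discount r t ≤ discount r s :=
  pow_le_pow_right_of_le_one' (ENNReal.ofReal_le_one.2 (by linarith)) h

theorem discount_eq_ofReal {r : ℝ} (hr : r ≤ 1) (t : ℕ) :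
    discount r t = ENNReal.ofReal ((1 - r) ^ t) := by
  rw [discount, ENNReal.ofReal_pow (by linarith)]

theorem u₁_le_two (n : ℕ) (y : List Bool) : u₁ n y ≤ 2 := by
  unfold u₁
  split_ifs <;> norm_num

theorem one_le_u₁ (n : ℕ) (y : List Bool) : 1 ≤ u₁ n y := by
  unfold u₁
  split_ifs <;> norm_num

theorem u₂_le_two (n : ℕ) (y : List Bool) : u₂ n y ≤ 2 := by
  unfold u₂
  split_ifs <;> norm_num

theorem u₁_add_u₂ (n : ℕ) (y : List Bool) : u₁ n y + u₂ n y = 3 := by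
  unfold u₁ u₂
  split_ifs <;> norm_num

theorem value₁_le (ε : ℝ) (t : ℕ) (x : List Bool) (b : Option (ℕ × List Bool)) :
    value₁ ε (some (t, x)) b ≤ 2 * discount ε t := by
  rcases b with _ | ⟨s, y⟩ <;> simp only [value₁] <;> split_ifs
  · rw [mul_comm]
    gcongr
    exact iSup_le fun y => u₁_le_two _ y
  · exact zero_le
  · rw [mul_comm]
    gcongr
    exact u₁_le_two _ y
  · exact zero_le

theorem discount_le_value₁ (ε : ℝ) (t : ℕ) {x : List Bool} (hx : 2 ≤ numVal x)
    (b : Option (ℕ × List Bool)) : discount ε t ≤ value₁ ε (some (t, x)) b := by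
  rcases b with _ | ⟨s, y⟩ <;> simp only [value₁, if_pos hx]
  · exact le_mul_of_one_le_right' ((one_le_u₁ _ []).trans (le_iSup (u₁ (numVal x)) []))
  · exact le_mul_of_one_le_right' (one_le_u₁ _ y)

theorem iSup_u₂_le_two (y : List Bool) : ⨆ n, ⨆ _ : 2 ≤ n, u₂ n y ≤ 2 :=
  iSup₂_le fun n _ => u₂_le_two n y

theorem value₂_le_two {δ : ℝ} (hδ : 0 ≤ δ) (a b : Option (ℕ × List Bool)) :
    value₂ δ a b ≤ 2 := by
  have h : ∀ (t : ℕ) (c : ℝ≥0∞), c ≤ 2 → discount δ t * c ≤ 2 := fun t c hc =>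
    (mul_le_mul' (discount_le_one hδ t) hc).trans_eq (one_mul 2)
  rcases a with _ | ⟨s, x⟩ <;> rcases b with _ | ⟨t, y⟩
  · exact zero_le
  · exact h t _ (iSup_u₂_le_two y)
  · exact zero_le
  · refine h t _ ?_
    split_ifs
    · exact u₂_le_two _ y
    · exact iSup_u₂_le_two y

/-- Undiscounted legal play has constant sum `3`, and discounting only lowers payoffs. In every
other case one player gets `0` and the other at most `2`. -/
theorem value₁_add_value₂_le_three {ε δ : ℝ} (hε : 0 ≤ ε) (hδ : 0 ≤ δ)
    (a b : Option (ℕ × List Bool)) : value₁ ε a b + value₂ δ a b ≤ 3 := by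
  have h23 : (2 : ℝ≥0∞) ≤ 3 := by norm_num
  rcases a with _ | ⟨s, x⟩
  · exact (zero_add (value₂ δ none b)).trans_le ((value₂_le_two hδ _ b).trans h23)
  · rcases b with _ | ⟨t, y⟩
    · refine (add_zero (value₁ ε (some (s, x)) none)).trans_le ((value₁_le ε s x none).trans ?_)
      exact (mul_le_of_le_one_right' (discount_le_one hε s)).trans h23
    · by_cases hx : 2 ≤ numVal x
      · simp only [value₁, value₂, if_pos hx]
        rw [← u₁_add_u₂ (numVal x) y]
        exact add_le_add (mul_le_of_le_one_left' (discount_le_one hε s))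
          (mul_le_of_le_one_left' (discount_le_one hδ t))
      · refine le_trans ?_ ((value₂_le_two hδ (some (s, x)) (some (t, y))).trans h23)
        simp [value₁, hx]

theorem payoff₂_le_two (ε : ℝ) {δ : ℝ} (hδ : 0 ≤ δ) (S T : Strategy) :
    payoff₂ ε δ S T ≤ 2 := by
  rw [payoff₂_eq]
  refine (lintegral_mono (g := fun _ => 2) fun a => ?_).trans (by simp)
  exact (replyValue_mono ε δ T fun b => value₂_le_two hδ a b).trans_eq
    (replyValue_const ε δ 2 T a)

theorem payoff₁_add_payoff₂_le_three {ε δ : ℝ} (hε : 0 ≤ ε) (hδ : 0 ≤ δ) (S T : Strategy) :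
    payoff₁ ε δ S T + payoff₂ ε δ S T ≤ 3 := by
  rw [payoff₁_eq, payoff₂_eq, ← lintegral_add_left Measurable.of_discrete]
  refine (lintegral_mono (g := fun _ => 3) fun a => ?_).trans (by simp)
  simp only [replyValue]
  rw [← ENNReal.tsum_add]
  refine le_trans (ENNReal.tsum_le_tsum fun N => ?_) (replyValue_const ε δ 3 T a).le
  rw [← mul_add]
  gcongr
  -- This direction of additivity needs no measurability in `ω`.
  exact (le_lintegral_add _ _).trans
    (lintegral_mono fun ω => value₁_add_value₂_le_three hε hδ a _)

/-! ### Alice deviates by truncation -/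

/-- The outcomes of computations that have not halted after `τ` steps. -/
def slow (τ : ℕ) : Set (Option (ℕ × List Bool)) := {a | ∀ t x, a = some (t, x) → τ < t}

theorem slow_anti {τ σ : ℕ} (h : τ ≤ σ) : slow σ ⊆ slow τ :=
  fun _ ha t x hx => h.trans_lt (ha t x hx)

theorem notMem_slow {τ : ℕ} {a : Option (ℕ × List Bool)} (h : a ∉ slow τ) :
    ∃ t x, a = some (t, x) ∧ t ≤ τ := by
  simpa [slow] using h

theorem PTM.truncate_outcome_of_mem_slow {M : PTM} {τ : ℕ} {inp : Fin 3 → List Bool}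
    {ω : ℕ → Bool} (h : M.outcome inp ω ∈ slow τ) :
    ∃ x, 2 ≤ numVal x ∧ (M.truncate τ).outcome inp ω = some (τ + 2, x) := by
  classical
  refine ⟨_, two_le_numVal_append _, truncate_outcome_of_forall_notMem fun s hs hmem => ?_⟩
  have hex : ∃ t, (M.run inp ω t).state ∈ M.halting := ⟨s, hmem⟩
  have := h (Nat.find hex) _ ((M.outcome_eq_some_iff inp ω _ _).2
    ⟨Nat.find_spec hex, fun _ => Nat.find_min hex, rfl⟩)
  have := Nat.find_min' hex hmem
  omega

theorem tsum_map_mul {α β : Type*} (p : PMF α) (f : α → β) (F : β → ℝ≥0∞) :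
    ∑' b, p.map f b * F b = ∑' a, p a * F (f a) := by
  classical
  simp_rw [PMF.map_apply, ← ENNReal.tsum_mul_right]
  rw [ENNReal.tsum_comm]
  congr 1 with a
  rw [tsum_eq_single (f a) fun b hb => by rw [if_neg hb, zero_mul], if_pos rfl]

theorem replyValue_value₁_le (ε δ : ℝ) (T : Strategy) (t : ℕ) (x : List Bool) :
    replyValue ε δ (value₁ ε) T (some (t, x)) ≤ 2 * discount ε t :=
  (replyValue_mono ε δ T fun b => value₁_le ε t x b).trans_eq (replyValue_const ε δ _ T _)

theorem replyValue_value₁_le_of_mem_slow {ε : ℝ} (hε : 0 ≤ ε) (δ : ℝ) (T : Strategy) {τ : ℕ}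
    {a : Option (ℕ × List Bool)} (ha : a ∈ slow τ) :
    replyValue ε δ (value₁ ε) T a ≤ 2 * discount ε τ := by
  rcases a with _ | ⟨t, x⟩
  · simp [replyValue, value₁]
  · refine (replyValue_value₁_le ε δ T t x).trans ?_
    gcongr
    exact discount_anti hε (ha t x rfl).le

theorem discount_le_replyValue_value₁ (ε δ : ℝ) (T : Strategy) (t : ℕ) {x : List Bool}
    (hx : 2 ≤ numVal x) : discount ε t ≤ replyValue ε δ (value₁ ε) T (some (t, x)) :=
  (replyValue_const ε δ _ T _).symm.trans_le
    (replyValue_mono ε δ T fun b => discount_le_value₁ ε t hx b)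

/-- Outcomes within time `τ`, and hence Bob's replies to them, are unchanged; all others become a
legal number at time `τ + 2`, worth at least `1` before discounting. -/
theorem le_payoff₁_map_truncate (ε δ : ℝ) (S T : Strategy) (τ : ℕ) :
    ∫⁻ a in (slow τ)ᶜ, replyValue ε δ (value₁ ε) T a ∂outcomeLaw ε δ S +
      discount ε (τ + 2) * outcomeLaw ε δ S (slow τ) ≤
    payoff₁ ε δ (S.map (PTM.truncate τ)) T := by
  rw [payoff₁_eq, lintegral_outcomeLaw ε δ (S.map (PTM.truncate τ)),
    tsum_map_mul S (PTM.truncate τ) fun M =>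
      ∫⁻ ω, replyValue ε δ (value₁ ε) T (outcome₁ ε δ M ω) ∂coins,
    ← lintegral_indicator (MeasurableSet.of_discrete),
    ← lintegral_indicator_const (MeasurableSet.of_discrete) (discount ε (τ + 2)),
    ← lintegral_add_left Measurable.of_discrete, lintegral_outcomeLaw]
  refine ENNReal.tsum_le_tsum fun M => ?_
  gcongr with ω
  by_cases h : outcome₁ ε δ M ω ∈ slow τ
  · obtain ⟨x, hx, hout⟩ := PTM.truncate_outcome_of_mem_slow h
    rw [Set.indicator_of_notMem (by simpa using h), Set.indicator_of_mem h, zero_add, outcome₁, hout]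
    exact discount_le_replyValue_value₁ ε δ T _ hx
  · obtain ⟨t, x, hout, ht⟩ := notMem_slow h
    rw [Set.indicator_of_mem (by simpa using h), Set.indicator_of_notMem h, add_zero, hout,
      outcome₁, PTM.truncate_outcome_of_le hout ht]

theorem payoff₁_ne_top {ε δ : ℝ} (hε : 0 ≤ ε) (hδ : 0 ≤ δ) (S T : Strategy) :
    payoff₁ ε δ S T ≠ ∞ :=
  ne_top_of_le_ne_top (by norm_num)
    (le_self_add.trans (payoff₁_add_payoff₂_le_three hε hδ S T))

/-- Fast outcomes contribute the same finite amount before and after truncation and cancel. What the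
slow ones earn in equilibrium is bounded separately for halting times up to `σ` and beyond. -/
theorem discount_mul_slow_le {ε δ : ℝ} (hε : 0 ≤ ε) (hδ : 0 ≤ δ) {η : ℝ≥0} {S T : Strategy}
    (h : IsApproxNE ε δ η S T) {τ σ : ℕ} (hτσ : τ ≤ σ) :
    discount ε (τ + 2) * outcomeLaw ε δ S (slow τ) ≤
      2 * discount ε τ * outcomeLaw ε δ S (slow τ \ slow σ) +
        2 * discount ε σ * outcomeLaw ε δ S (slow σ) + η := by
  have h₁ := (le_payoff₁_map_truncate ε δ S T τ).trans (h.1 _)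
  have hfin := payoff₁_ne_top hε hδ S T
  rw [payoff₁_eq, ← lintegral_add_compl (μ := outcomeLaw ε δ S) _
    (MeasurableSet.of_discrete (s := slow τ))] at hfin
  rw [payoff₁_eq, ← lintegral_add_compl (μ := outcomeLaw ε δ S) _
    (MeasurableSet.of_discrete (s := slow τ))] at h₁
  rw [add_comm (∫⁻ a in slow τ, _ ∂_), add_assoc] at h₁
  refine (ENNReal.le_of_add_le_add_left (ENNReal.add_ne_top.1 hfin).2 h₁).trans ?_
  gcongr
  have hu : slow τ = slow τ \ slow σ ∪ slow σ := (Set.sdiff_union_of_subset (slow_anti hτσ)).symm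
  conv_lhs => rw [hu]
  rw [lintegral_union MeasurableSet.of_discrete Set.disjoint_sdiff_left,
    ← setLIntegral_const, ← setLIntegral_const]
  gcongr ?_ + ?_
  · exact setLIntegral_mono' MeasurableSet.of_discrete fun a ha =>
      replyValue_value₁_le_of_mem_slow hε δ T ha.1
  · exact setLIntegral_mono' MeasurableSet.of_discrete fun a ha =>
      replyValue_value₁_le_of_mem_slow hε δ T ha

theorem pow_mul_slow_le {ε δ : ℝ} (hε : 0 ≤ ε) (hε' : ε ≤ 1) (hδ : 0 ≤ δ) {η : ℝ≥0}
    {S T : Strategy} (h : IsApproxNE ε δ η S T) {τ σ : ℕ} (hτσ : τ ≤ σ) :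
    (1 - ε) ^ (τ + 2) * (outcomeLaw ε δ S).real (slow τ) ≤
      2 * (1 - ε) ^ τ * ((outcomeLaw ε δ S).real (slow τ) - (outcomeLaw ε δ S).real (slow σ)) +
        2 * (1 - ε) ^ σ * (outcomeLaw ε δ S).real (slow σ) + η := by
  have h₁ := discount_mul_slow_le hε hδ h hτσ
  have h₀ : 0 ≤ 1 - ε := by linarith
  rw [← measureReal_sdiff (slow_anti hτσ) MeasurableSet.of_discrete]
  rw [← ofReal_measureReal (s := slow τ), ← ofReal_measureReal (s := slow σ),
    ← ofReal_measureReal (s := slow τ \ slow σ)] at h₁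
  simp only [discount_eq_ofReal hε'] at h₁
  rw [← ENNReal.ofReal_coe_nnreal, show (2 : ℝ≥0∞) = ENNReal.ofReal 2 by simp] at h₁
  rw [← ENNReal.ofReal_mul (by positivity), ← ENNReal.ofReal_mul (by positivity),
    ← ENNReal.ofReal_mul (by positivity), ← ENNReal.ofReal_mul (by positivity),
    ← ENNReal.ofReal_mul (by positivity),
    ← ENNReal.ofReal_add (by positivity) (by positivity),
    ← ENNReal.ofReal_add (by positivity) (by positivity)] at h₁
  exact (ENNReal.ofReal_le_ofReal_iff (by positivity)).1 h₁

/-- The machine that never halts. -/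
def PTM.idle : PTM where
  State := Unit
  finiteState := inferInstance
  Extra := Empty
  finiteExtra := inferInstance
  workTapes := 0
  start := ()
  halting := ∅
  action _ h _ := { next := (), write := h, move := fun _ => none, emit := none }

/-- Truncating the idle machine at time `0` gives a machine that names `3` in two steps. -/
theorem discount_two_le_payoff₁_add {ε δ : ℝ} {η : ℝ≥0} {S T : Strategy}
    (h : IsApproxNE ε δ η S T) : discount ε 2 ≤ payoff₁ ε δ S T + η := by
  refine le_trans ?_ (h.1 ((PMF.pure PTM.idle).map (PTM.truncate 0)))
  refine le_trans ?_ (le_payoff₁_map_truncate ε δ _ T 0)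
  have hlaw : outcomeLaw ε δ (PMF.pure PTM.idle) (slow 0) = 1 := by
    rw [← lintegral_indicator_one MeasurableSet.of_discrete, lintegral_outcomeLaw,
      tsum_eq_single PTM.idle fun M hM => by rw [PMF.pure_apply_of_ne _ _ hM, zero_mul]]
    have hnone : ∀ ω, outcome₁ ε δ PTM.idle ω = none := fun ω =>
      dif_neg fun ⟨_, ht⟩ => ht
    have hmem : (none : Option (ℕ × List Bool)) ∈ slow 0 := by simp [slow]
    simp [hnone, hmem]
  rw [hlaw, mul_one, zero_add]
  exact le_add_self

/-! ### Bob deviates to a table -/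

theorem le_value₂_factorAnswer (δ : ℝ) (s t : ℕ) (x : List Bool) :
    2 * discount δ t ≤ value₂ δ (some (s, x)) (some (t, factorAnswer x)) := by
  rw [mul_comm]
  simp only [value₂]
  gcongr
  split_ifs with hx
  · rw [u₂, if_pos (isFactorization_factorAnswer hx)]
  -- After an illegal message Bob is paid the best case over `n`; the case `n = 2` already gives
  -- `2`.
  · refine le_trans ?_ (le_iSup₂ (f := fun n (_ : 2 ≤ n) => u₂ n (factorAnswer x)) 2 le_rfl)
    rw [u₂, if_pos (isFactorization_two_factorAnswer hx)]

/-- A message of at most `τ` bits has an answer of at most `5 * τ + 5` bits, so the table takes at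
most `τ + 1 + (5 * τ + 5)` steps. -/
theorem le_payoff₂_lookup (ε : ℝ) {δ : ℝ} (hδ : 0 ≤ δ) (S : Strategy) (τ : ℕ) :
    2 * discount δ (6 * τ + 6) * outcomeLaw ε δ S (slow τ)ᶜ ≤
      payoff₂ ε δ S (PMF.pure (PTM.lookup (5 * τ + 5) factorAnswer)) := by
  rw [payoff₂_eq, lintegral_outcomeLaw, ← lintegral_indicator_const MeasurableSet.of_discrete,
    lintegral_outcomeLaw]
  refine ENNReal.tsum_le_tsum fun M => ?_
  gcongr with ω
  by_cases h : outcome₁ ε δ M ω ∈ slow τ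
  · rw [Set.indicator_of_notMem (by simpa using h)]
    exact zero_le
  rw [Set.indicator_of_mem h]
  obtain ⟨t, x, hout, ht⟩ := notMem_slow h
  have hlen : x.length ≤ τ := (PTM.length_le_of_outcome_eq_some hout).trans ht
  have hans := length_factorAnswer_le x
  rw [replyValue, tsum_eq_single (PTM.lookup (5 * τ + 5) factorAnswer) fun N hN => by
    rw [PMF.pure_apply_of_ne _ _ hN, zero_mul], PMF.pure_apply_self, one_mul, hout]
  refine le_trans ?_ (lintegral_mono (f := fun _ => 2 * discount δ (6 * τ + 6)) fun ω' => ?_)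
  · simp
  have hbob : outcome₂ ε δ (some (t, x)) (PTM.lookup (5 * τ + 5) factorAnswer) ω' =
      some (x.length + 1 + (factorAnswer x).length, factorAnswer x) :=
    PTM.lookup_outcome (5 * τ + 5) factorAnswer (inputs ε δ x) ω'
      (show x.length ≤ _ by omega) (show (factorAnswer x).length ≤ _ by omega)
  rw [hbob]
  refine le_trans ?_ (le_value₂_factorAnswer δ t _ x)
  change 2 * discount δ (6 * τ + 6) ≤ _
  gcongr
  exact discount_anti hδ (by omega)

theorem le_payoff₂_add {ε δ : ℝ} (hδ : 0 ≤ δ) (hδ' : δ ≤ 1) {η : ℝ≥0} {S T : Strategy}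
    (h : IsApproxNE ε δ η S T) (τ : ℕ) :
    2 * (1 - δ) ^ (6 * τ + 6) * (1 - (outcomeLaw ε δ S).real (slow τ)) ≤
      (payoff₂ ε δ S T).toReal + η := by
  have h₁ := (le_payoff₂_lookup ε hδ S τ).trans (h.2 _)
  have hfin : payoff₂ ε δ S T ≠ ∞ := ne_top_of_le_ne_top (by norm_num) (payoff₂_le_two ε hδ S T)
  have h₂ := ENNReal.toReal_mono (by finiteness) h₁
  rw [discount_eq_ofReal hδ', ENNReal.toReal_mul, ENNReal.toReal_mul,
    ENNReal.toReal_ofReal (pow_nonneg (by linarith) _), ENNReal.toReal_add hfin (by finiteness)] at h₂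
  rw [← probReal_compl_eq_one_sub MeasurableSet.of_discrete]
  exact h₂

/-! ### Decay of Alice's running time on the scale `1 / ε` -/

/-- Because `(1 - x) * (1 + 2 * x) = 1 + x * (1 - 2 * x) ≥ 1`. -/
theorem exp_neg_two_mul_le_one_sub {x : ℝ} (h₀ : 0 ≤ x) (h₁ : x ≤ 1 / 2) :
    Real.exp (-(2 * x)) ≤ 1 - x := by
  have h := Real.add_one_le_exp (2 * x)
  rw [Real.exp_neg, inv_le_iff_one_le_mul₀ (Real.exp_pos _)]
  nlinarith

theorem one_sub_pow_ceil_le {ε : ℝ} (h₀ : 0 < ε) (h₁ : ε ≤ 1) :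
    (1 - ε) ^ ⌈3 / ε⌉₊ ≤ 1 / 8 := by
  have hm : 3 ≤ (⌈3 / ε⌉₊ : ℝ) * ε := (div_le_iff₀ h₀).1 (Nat.le_ceil _)
  calc (1 - ε) ^ ⌈3 / ε⌉₊ ≤ Real.exp (-ε) ^ ⌈3 / ε⌉₊ :=
        pow_le_pow_left₀ (by linarith) (Real.one_sub_le_exp_neg ε) _
    _ = Real.exp (⌈3 / ε⌉₊ * -ε) := (Real.exp_nat_mul _ _).symm
    _ ≤ Real.exp (-3) := Real.exp_le_exp.2 (by linarith)
    _ ≤ 1 / 8 := by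
      rw [Real.exp_neg, one_div]
      refine inv_anti₀ (by norm_num) ?_
      have h2 : (2 : ℝ) ≤ Real.exp 1 := by linarith [Real.add_one_le_exp 1]
      calc (8 : ℝ) = 2 ^ 3 := by norm_num
        _ ≤ Real.exp 1 ^ 3 := by gcongr
        _ = Real.exp 3 := by rw [← Real.exp_nat_mul]; norm_num

theorem natCeil_div_le {ε : ℝ} (h₀ : 0 < ε) (h₁ : ε ≤ 1) : (⌈3 / ε⌉₊ : ℝ) ≤ 4 / ε := by
  have h := (Nat.ceil_lt_add_one (show 0 ≤ 3 / ε by positivity)).le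
  have h' : 1 ≤ 1 / ε := (one_le_div h₀).2 h₁
  calc (⌈3 / ε⌉₊ : ℝ) ≤ 3 / ε + 1 / ε := h.trans (by linarith)
    _ = 4 / ε := by ring

theorem exp_le_one_sub_pow_ceil {ε : ℝ} (h₀ : 0 < ε) (h₁ : ε ≤ 1 / 2) :
    Real.exp (-8) ≤ (1 - ε) ^ ⌈3 / ε⌉₊ := by
  have hm : (⌈3 / ε⌉₊ : ℝ) * ε ≤ 4 :=
    (le_div_iff₀ h₀).1 (natCeil_div_le h₀ (by linarith))
  calc Real.exp (-8) ≤ Real.exp (⌈3 / ε⌉₊ * -(2 * ε)) := Real.exp_le_exp.2 (by linarith)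
    _ = Real.exp (-(2 * ε)) ^ ⌈3 / ε⌉₊ := Real.exp_nat_mul _ _
    _ ≤ (1 - ε) ^ ⌈3 / ε⌉₊ :=
      pow_le_pow_left₀ (Real.exp_pos _).le (exp_neg_two_mul_le_one_sub h₀.le h₁) _

/-- Let `p`, `q` be the probabilities of surviving `k` and `k + 1` windows. Dividing the equilibrium
inequality by the discount of the first `k` windows leaves `3 / 4 * p ≤ 2 * (p - q) + 1 / 4 * q +
E`, that is, `7 * q ≤ 5 * p + 4 * E`. -/
theorem slow_add_ceil_le {ε δ : ℝ} (hε : 0 < ε) (hε' : ε ≤ 1 / 8) (hδ : 0 ≤ δ) {η : ℝ≥0}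
    {S T : Strategy} (h : IsApproxNE ε δ η S T) (k : ℕ) :
    (outcomeLaw ε δ S).real (slow ((k + 1) * ⌈3 / ε⌉₊)) ≤
      5 / 7 * (outcomeLaw ε δ S).real (slow (k * ⌈3 / ε⌉₊)) + Real.exp (8 * k) * η := by
  have key := pow_mul_slow_le hε.le (by linarith) hδ h
    (show k * ⌈3 / ε⌉₊ ≤ (k + 1) * ⌈3 / ε⌉₊ by gcongr; omega)
  have hp := measureReal_nonneg (μ := outcomeLaw ε δ S) (s := slow (k * ⌈3 / ε⌉₊))
  have hq := measureReal_nonneg (μ := outcomeLaw ε δ S) (s := slow ((k + 1) * ⌈3 / ε⌉₊))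
  generalize (outcomeLaw ε δ S).real (slow (k * ⌈3 / ε⌉₊)) = p at *
  generalize (outcomeLaw ε δ S).real (slow ((k + 1) * ⌈3 / ε⌉₊)) = q at *
  have hm := one_sub_pow_ceil_le hε (by linarith)
  have hl := exp_le_one_sub_pow_ceil hε (by linarith)
  rw [pow_add, add_one_mul, pow_add, mul_comm k, pow_mul] at key
  generalize hr : (1 - ε) ^ ⌈3 / ε⌉₊ = r at *
  have hd : 0 < r ^ k := pow_pos ((Real.exp_pos _).trans_le hl) k
  -- The division inflates the error by `r ^ (-k)`, at most `exp (8 * k)`: harmless, since `k` stays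
  -- fixed as `ε → 0`.
  have hη : (η : ℝ) ≤ r ^ k * (Real.exp (8 * k) * η) := by
    have h1 : 1 ≤ r ^ k * Real.exp (8 * k) := by
      calc (1 : ℝ) = Real.exp (-8) ^ k * Real.exp (8 * k) := by
            rw [← Real.exp_nat_mul, ← Real.exp_add]
            simp [mul_comm]
        _ ≤ r ^ k * Real.exp (8 * k) := by gcongr
    calc (η : ℝ) = 1 * η := (one_mul _).symm
      _ ≤ r ^ k * Real.exp (8 * k) * η := by gcongr
      _ = _ := mul_assoc _ _ _
  have hE : 0 ≤ Real.exp (8 * k) * η := by positivity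
  generalize Real.exp (8 * k) * η = E at *
  have h2 : (1 - ε) ^ 2 * p ≤ 2 * (p - q) + 2 * r * q + E := by
    refine le_of_mul_le_mul_left ?_ hd
    linarith
  -- For `ε ≤ 1 / 8`, `(1 - ε) ^ 2 ≥ 49 / 64`.
  have h3 : 3 / 4 * p ≤ (1 - ε) ^ 2 * p := by
    gcongr
    nlinarith
  have h4 : r * q ≤ 1 / 8 * q := by gcongr
  linarith

theorem eventually_slow_le {δ : ℝ → ℝ} {S T : Strategy} {f : ℝ → ℝ≥0}
    (hf : Tendsto f (𝓝[>] 0) (𝓝 0))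
    (hNE : ∀ᶠ ε in 𝓝[>] (0 : ℝ), 0 ≤ δ ε ∧ IsApproxNE ε (δ ε) (f ε) S T) (k : ℕ) {η : ℝ}
    (hη : 0 < η) :
    ∀ᶠ ε in 𝓝[>] (0 : ℝ),
      (outcomeLaw ε (δ ε) S).real (slow (k * ⌈3 / ε⌉₊)) ≤ (5 / 7) ^ k + η := by
  induction k generalizing η with
  | zero =>
    refine Eventually.of_forall fun ε => ?_
    have := measureReal_le_one (μ := outcomeLaw ε (δ ε) S) (s := slow (0 * ⌈3 / ε⌉₊))
    rw [pow_zero]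
    linarith
  | succ k ih =>
    have hf' : Tendsto (fun ε => Real.exp (8 * k) * (f ε : ℝ)) (𝓝[>] 0) (𝓝 0) := by
      simpa using (NNReal.tendsto_coe.2 hf).const_mul (Real.exp (8 * k))
    -- An error `2 / 7 * η` per window keeps the total at `η`, as `5 / 7 * η + 2 / 7 * η = η`.
    filter_upwards [ih hη, hNE, hf'.eventually_lt_const (show 0 < 2 / 7 * η by positivity),
      Ioc_mem_nhdsGT (show (0 : ℝ) < 1 / 8 by norm_num)] with ε h₁ h₂ h₃ h₄
    have := slow_add_ceil_le h₄.1 h₄.2 h₂.1 h₂.2 k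
    rw [pow_succ]
    linarith

theorem one_sub_mul_le_pow {δ : ℝ} (hδ : δ ≤ 1) (n : ℕ) : 1 - n * δ ≤ (1 - δ) ^ n := by
  have := one_add_mul_le_pow (show -2 ≤ -δ by linarith) n
  rw [← sub_eq_add_neg] at this
  linarith

theorem eventually_one_sub_le_pow {δ : ℝ → ℝ} (hpos : ∀ᶠ ε in 𝓝[>] (0 : ℝ), 0 < δ ε)
    (ho : δ =o[𝓝[>] (0 : ℝ)] fun ε : ℝ => ε) (k : ℕ) {η : ℝ} (hη : 0 < η) :
    ∀ᶠ ε in 𝓝[>] (0 : ℝ), 1 - η ≤ (1 - δ ε) ^ (6 * (k * ⌈3 / ε⌉₊) + 6) := by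
  -- The exponent is at most `(24 * k + 6) / ε`, so this ratio `δ / ε` keeps its product with `δ`
  -- below `η`; the `1` in the minimum ensures `δ ≤ 1`.
  have hc : 0 < min 1 (η / (24 * k + 6)) := by positivity
  filter_upwards [hpos, ho.bound hc, Ioc_mem_nhdsGT (show (0 : ℝ) < 1 by norm_num)] with ε h₁ h₂ h₃
  rw [Real.norm_of_nonneg h₁.le, Real.norm_of_nonneg h₃.1.le] at h₂
  have hδ : δ ε ≤ 1 := h₂.trans (mul_le_one₀ (min_le_left _ _) h₃.1.le h₃.2)
  refine le_trans ?_ (one_sub_mul_le_pow hδ _)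
  have hm : (⌈3 / ε⌉₊ : ℝ) * ε ≤ 4 := (le_div_iff₀ h₃.1).1 (natCeil_div_le h₃.1 h₃.2)
  have hn : ((6 * (k * ⌈3 / ε⌉₊) + 6 : ℕ) : ℝ) * ε ≤ 24 * k + 6 := by
    push_cast
    have := mul_le_mul_of_nonneg_left hm (Nat.cast_nonneg (α := ℝ) k)
    nlinarith [h₃.2]
  have hK : (0 : ℝ) < 24 * k + 6 := by positivity
  have : ((6 * (k * ⌈3 / ε⌉₊) + 6 : ℕ) : ℝ) * δ ε ≤ η := by
    calc ((6 * (k * ⌈3 / ε⌉₊) + 6 : ℕ) : ℝ) * δ ε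
        ≤ ((6 * (k * ⌈3 / ε⌉₊) + 6 : ℕ) : ℝ) * (η / (24 * k + 6) * ε) := by
          gcongr
          exact h₂.trans (mul_le_mul_of_nonneg_right (min_le_right _ _) h₃.1.le)
      _ = η / (24 * k + 6) * (((6 * (k * ⌈3 / ε⌉₊) + 6 : ℕ) : ℝ) * ε) := by ring
      _ ≤ η / (24 * k + 6) * (24 * k + 6) := by gcongr
      _ = η := div_mul_cancel₀ _ hK.ne'
  linarith

/-! ### The limits of the payoffs -/

theorem eventually_isApproxNE {δ : ℝ → ℝ} (hpos : ∀ᶠ ε in 𝓝[>] (0 : ℝ), 0 < δ ε)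
    (ho : δ =o[𝓝[>] (0 : ℝ)] fun ε : ℝ => ε) {S T : Strategy} {f : ℝ → ℝ≥0}
    (hf : ∀ ε : ℝ, 0 < ε → ε < 1 → 0 < δ ε → δ ε < 1 → IsApproxNE ε (δ ε) (f ε) S T) :
    ∀ᶠ ε in 𝓝[>] (0 : ℝ),
      0 < ε ∧ ε < 1 ∧ 0 < δ ε ∧ δ ε < 1 ∧ IsApproxNE ε (δ ε) (f ε) S T := by
  filter_upwards [hpos, ho.bound one_pos, Ioo_mem_nhdsGT (show (0 : ℝ) < 1 by norm_num)]
    with ε h₁ h₂ h₃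
  rw [Real.norm_of_nonneg h₁.le, Real.norm_of_nonneg h₃.1.le, one_mul] at h₂
  have hlt := h₂.trans_lt h₃.2
  exact ⟨h₃.1, h₃.2, h₁, hlt, hf ε h₃.1 h₃.2 h₁ hlt⟩

theorem tendsto_toReal_payoff₂ {δ : ℝ → ℝ} (hpos : ∀ᶠ ε in 𝓝[>] (0 : ℝ), 0 < δ ε)
    (ho : δ =o[𝓝[>] (0 : ℝ)] fun ε : ℝ => ε) {S T : Strategy}
    (hST : IsStrongUniformNE δ S T) :
    Tendsto (fun ε : ℝ => (payoff₂ ε (δ ε) S T).toReal) (𝓝[>] 0) (𝓝 2) := by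
  obtain ⟨f, hf, hNE⟩ := hST
  have hev := eventually_isApproxNE hpos ho hNE
  refine tendsto_order.2 ⟨fun c hc => ?_, fun c hc => ?_⟩
  -- With slow probability below `2 * η`, Bob's payoff is at least `2 * (1 - η) * (1 - 2 * η) - η >
  -- 2 - 8 * η = c`. The number `k` of windows is fixed by `η` before `ε` becomes small.
  · set η := (2 - c) / 8 with hη
    have hη₀ : 0 < η := by linarith
    obtain ⟨k, hk⟩ := exists_pow_lt_of_lt_one hη₀ (show (5 / 7 : ℝ) < 1 by norm_num)
    filter_upwards [hev, eventually_slow_le hf (hev.mono fun ε h => ⟨h.2.2.1.le, h.2.2.2.2⟩) k hη₀,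
      eventually_one_sub_le_pow hpos ho k hη₀,
      (NNReal.tendsto_coe.2 hf).eventually_lt_const hη₀] with ε h₁ h₂ h₃ h₄
    obtain ⟨-, -, hδ, hδ', hne⟩ := h₁
    have h₅ := le_payoff₂_add hδ.le hδ'.le hne (k * ⌈3 / ε⌉₊)
    have hp := measureReal_nonneg (μ := outcomeLaw ε (δ ε) S) (s := slow (k * ⌈3 / ε⌉₊))
    have hp' := measureReal_le_one (μ := outcomeLaw ε (δ ε) S) (s := slow (k * ⌈3 / ε⌉₊))
    have h₆ := mul_le_mul_of_nonneg_right h₃ (sub_nonneg.2 hp')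
    nlinarith [mul_nonneg hη₀.le hp]
  · filter_upwards [hpos] with ε h
    refine lt_of_le_of_lt ?_ hc
    exact ENNReal.toReal_le_of_le_ofReal (by norm_num) (by simpa using payoff₂_le_two ε h.le S T)

/-- Squeezed between naming `3` at once and what Bob leaves of the total `3`. -/
theorem tendsto_toReal_payoff₁ {δ : ℝ → ℝ} (hpos : ∀ᶠ ε in 𝓝[>] (0 : ℝ), 0 < δ ε)
    (ho : δ =o[𝓝[>] (0 : ℝ)] fun ε : ℝ => ε) {S T : Strategy}
    (hST : IsStrongUniformNE δ S T) :
    Tendsto (fun ε : ℝ => (payoff₁ ε (δ ε) S T).toReal) (𝓝[>] 0) (𝓝 1) := by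
  have h₂ := tendsto_toReal_payoff₂ hpos ho hST
  obtain ⟨f, hf, hNE⟩ := hST
  have hev := eventually_isApproxNE hpos ho hNE
  have hlow : Tendsto (fun ε : ℝ => (1 - ε) ^ 2 - (f ε : ℝ)) (𝓝[>] 0) (𝓝 1) := by
    have hid : Tendsto (fun ε : ℝ => ε) (𝓝[>] 0) (𝓝 0) := tendsto_nhdsWithin_of_tendsto_nhds tendsto_id
    simpa using ((hid.const_sub 1).pow 2).sub (NNReal.tendsto_coe.2 hf)
  have hup : Tendsto (fun ε : ℝ => 3 - (payoff₂ ε (δ ε) S T).toReal) (𝓝[>] 0) (𝓝 1) := by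
    have := h₂.const_sub 3
    norm_num at this
    exact this
  refine tendsto_of_tendsto_of_tendsto_of_le_of_le' hlow hup ?_ ?_
  · filter_upwards [hev] with ε ⟨hε, hε', hδ, hδ', hne⟩
    have hfin := payoff₁_ne_top hε.le hδ.le S T
    have h := ENNReal.toReal_mono (by finiteness) (discount_two_le_payoff₁_add hne)
    rw [discount_eq_ofReal hε'.le, ENNReal.toReal_ofReal (by positivity),
      ENNReal.toReal_add hfin (by finiteness)] at h
    exact sub_le_iff_le_add.2 h
  · filter_upwards [hev] with ε ⟨hε, hε', hδ, hδ', hne⟩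
    have hfin := payoff₁_ne_top hε.le hδ.le S T
    have hfin₂ : payoff₂ ε (δ ε) S T ≠ ∞ :=
      ne_top_of_le_ne_top (by norm_num) (payoff₂_le_two ε hδ.le S T)
    have h := ENNReal.toReal_mono (by norm_num) (payoff₁_add_payoff₂_le_three hε.le hδ.le S T)
    rw [ENNReal.toReal_add hfin hfin₂] at h
    exact le_sub_iff_add_le.2 h

end FactoringGame

theorem theorem3 (δ : ℝ → ℝ) (hpos : ∀ᶠ ε in 𝓝[>] (0 : ℝ), 0 < δ ε)
    (ho : δ =o[𝓝[>] (0 : ℝ)] fun ε : ℝ => ε)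
    (S T : FactoringGame.Strategy) (hST : FactoringGame.IsStrongUniformNE δ S T) :
    Tendsto (fun ε : ℝ => FactoringGame.payoff₁ ε (δ ε) S T) (𝓝[>] 0) (𝓝 1) ∧
      Tendsto (fun ε : ℝ => FactoringGame.payoff₂ ε (δ ε) S T) (𝓝[>] 0) (𝓝 2) := by
  have hεpos : ∀ᶠ ε in 𝓝[>] (0 : ℝ), 0 < ε := self_mem_nhdsWithin
  constructor
  · have h := ENNReal.tendsto_ofReal (FactoringGame.tendsto_toReal_payoff₁ hpos ho hST)
    rw [ENNReal.ofReal_one] at h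
    refine h.congr' ?_
    filter_upwards [hpos, hεpos] with ε hδ hε
    exact ENNReal.ofReal_toReal (FactoringGame.payoff₁_ne_top hε.le hδ.le S T)
  · have h := ENNReal.tendsto_ofReal (FactoringGame.tendsto_toReal_payoff₂ hpos ho hST)
    rw [ENNReal.ofReal_ofNat] at h
    refine h.congr' ?_
    filter_upwards [hpos] with ε hδ
    exact ENNReal.ofReal_toReal
      (ne_top_of_le_ne_top (by norm_num) (FactoringGame.payoff₂_le_two ε hδ.le S T))
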